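/- **Theorem (Minimax lower bound).** Let $\mathcal X\subset\mathbb R^d$ be compact, $\mu$ a Borel (hence Radon) probability measure on $\mathcal X$, and $k:\mathcal X\times\mathcal X\to\mathbb R$ a symmetric positive semidefinite kernel which is $2h$-Hölder for some $h\in(0,\frac12]$, i.e. $|k(x_1,x_2)-k(x_1',x_2')|\le L_k|(x_1,x_2)-(x_1',x_2')|^{2h}$ on $\mathcal X\times\mathcal X$. Let $\lambda_1\ge\lambda_2\ge\dots>0$ be the eigenvalues of the integral operator $Tf(x)=\int_{\mathcal X}k(x,\xi)f(\xi)\,d\mu(\xi)$ and $e_1,e_2,\dots$ corresponding (continuous) eigenfunctions, satisfying $Te_i(x)=\lambda_ie_i(x)$ for every $x\in\mathcal X$ and forming an orthonormal basis of $L^2(\mathcal X,\mu)$. Assume, for some $\beta>0$ and positive constants $c,c'$: * (eigenvalue decay) $c\,i^{-\beta}\le\lambda_i\le c'\,i^{-\beta}$ for all $i\ge1$; * (embedding index) $\inf\{\alpha\in[\frac1\beta,1]:\ M_\alpha<\infty\}=\frac1\beta$, where $M_\alpha^2=\sup_{x\in\mathcal X}\sum_{i\ge1}\lambda_i^\alpha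 e_i(x)^2\in[0,\infty]$. Let $s>\frac1\beta$, $R>0$, $\sigma>0$, let $$[\mathcal H]^s=\Big\{\sum_{i\ge1}a_i\lambda_i^{s/2}e_i:\ (a_i)\in\ell^2\Big\},\qquad \Big\|\sum_{i\ge1}a_i\lambda_i^{s/2}e_i\Big\|_{[\mathcal H]^s}=\|(a_i)\|_{\ell^2}$$ (the series being summed pointwise on $\mathcal X$), and $\mathcal B(R)=\{f\in[\mathcal H]^s:\|f\|_{[\mathcal H]^s}\le R\}$. For $f^*\in\mathcal B(R)$ one observes $(x_j,y_j)$, $j=1,\dots,n$, with $y_j=f^*(x_j)+\varepsilon_j$, where $x_1,\dots,x_n\sim\mu$ and $\varepsilon_1,\dots,\varepsilon_n\sim N(0,\sigma^2)$ are all independent. Then there is a constant $C>0$, depending only on $\sigma,d,\beta,L_k,h,s,R$ and $c$, such that for every $n\ge1$ $$\inf_{\hat f}\ \sup_{f^*\in\mathcal B(R)}\mathbb E\,\|\hat f-f^*\|_\infty\ \ge\ C\,n^{-\frac{s\beta-1}{2s\beta}},$$ where $\|g\|_\infty=\sup_{x\in\mathcal X}|g(x)|$ and the infimum is over all estimators $\hat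 f$, i.e. all maps from samples $(x_j,y_j)_{j\le n}$ to functions on $\mathcal X$ whose value at each point is a measurable function of the sample. Hence a rate $K n^{-\frac{s\beta-1}{2s\beta}+\varepsilon}$ with $K,\varepsilon>0$ (the form of the upper bound known for kernel gradient flow) cannot be improved by more than a factor of order $n^\varepsilon$: for every $n\ge 1$, $$K n^{-\frac{s\beta-1}{2s\beta}+\varepsilon}\ \le\ \frac{K}{C}\,n^{\varepsilon}\ \inf_{\hat f}\ \sup_{f^*\in\mathcal B(R)}\mathbb E\,\|\hat f-f^*\|_\infty .$$ -/

import Mathlib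

open MeasureTheory ProbabilityTheory
open scoped ENNReal NNReal

namespace KernelRegression

/-- The integral operator `(T f)(x) = ∫ k(x, ξ) f(ξ) dμ(ξ)`. -/
noncomputable def integralOp {X : Type*} [MeasurableSpace X] (μ : Measure X) (k : X → X → ℝ)
    (f : X → ℝ) : X → ℝ :=
  fun x => ∫ ξ, k x ξ * f ξ ∂μ

/-- `lam 0 ≥ lam 1 ≥ … > 0` are the eigenvalues of the integral operator of `k` on `L²(μ)`, and
`e 0, e 1, …` are corresponding eigenfunctions, which form an orthonormal basis of `L²(μ)`.
The eigenvalue equation is required at every point, which selects the version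
`e i = (lam i)⁻¹ T (e i)` of each eigenfunction (the continuous one when `k` is continuous), so that
the values `e i x` are meaningful. -/
structure IsEigensystem {X : Type*} [MeasurableSpace X] (μ : Measure X) (k : X → X → ℝ)
    (lam : ℕ → ℝ) (e : ℕ → X → ℝ) : Prop where
  pos : ∀ i, 0 < lam i
  antitone : Antitone lam
  memLp : ∀ i, MemLp (e i) 2 μ
  eigen : ∀ i x, integralOp μ k (e i) x = lam i * e i x
  orthonormal : ∀ i j, ∫ x, e i x * e j x ∂μ = if i = j then 1 else 0
  complete : ∀ f : X → ℝ, MemLp f 2 μ → (∀ i, ∫ x, f x * e i x ∂μ = 0) → f =ᵐ[μ] 0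

/-- Eigenvalue decay `c i^{-β} ≤ λ_i ≤ C i^{-β}` for `i = 1, 2, …`; here `λ_i = lam (i - 1)`. -/
def EigenvalueDecay (lam : ℕ → ℝ) (β c C : ℝ) : Prop :=
  ∀ i : ℕ, c * ((i : ℝ) + 1) ^ (-β) ≤ lam i ∧ lam i ≤ C * ((i : ℝ) + 1) ^ (-β)

/-- The kernel is `2h`-Hölder with constant `L`, jointly in both variables, with respect to the
Euclidean distance on `X × X`. -/
def HolderKernel {X : Type*} [PseudoMetricSpace X] (k : X → X → ℝ) (h L : ℝ) : Prop :=
  ∀ x₁ x₂ x₁' x₂' : X,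
    |k x₁ x₂ - k x₁' x₂'| ≤ L * Real.sqrt (dist x₁ x₁' ^ 2 + dist x₂ x₂' ^ 2) ^ (2 * h)

/-- The square `M_α² = sup_x ∑ᵢ λ_i^α e_i(x)² ∈ [0, ∞]` of the embedding coefficient. -/
noncomputable def embeddingCoeffSq {X : Type*} (lam : ℕ → ℝ) (e : ℕ → X → ℝ) (α : ℝ) : ℝ≥0∞ :=
  ⨆ x : X, ∑' i : ℕ, ENNReal.ofReal (lam i ^ α * e i x ^ 2)

/-- `α₀` is the embedding index `inf {α ∈ [1/β, 1] : M_α < ∞}` (the set being non-empty). -/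
def IsEmbeddingIndex {X : Type*} (lam : ℕ → ℝ) (e : ℕ → X → ℝ) (β α₀ : ℝ) : Prop :=
  IsGLB {α : ℝ | α ∈ Set.Icc (1 / β) 1 ∧ embeddingCoeffSq lam e α < ∞} α₀

/-- The ball `{f ∈ [H]^s : ‖f‖_{[H]^s} ≤ R}` of the interpolation space
`[H]^s = {∑ᵢ aᵢ λ_i^{s/2} e_i : a ∈ ℓ²}` with norm `‖∑ᵢ aᵢ λ_i^{s/2} e_i‖_{[H]^s} = ‖a‖_{ℓ²}`.
Its elements are functions defined at every point, by the pointwise sum of the series. -/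
def interpolationBall {X : Type*} (lam : ℕ → ℝ) (e : ℕ → X → ℝ) (s R : ℝ) : Set (X → ℝ) :=
  {f | ∃ a : lp (fun _ : ℕ => ℝ) 2, ‖a‖ ≤ R ∧
    ∀ x, HasSum (fun i => a i * lam i ^ (s / 2) * e i x) (f x)}

/-- The supremum distance `‖f - g‖_∞ = sup_x |f(x) - g(x)| ∈ [0, ∞]`. -/
noncomputable def supDist {X : Type*} (f g : X → ℝ) : ℝ≥0∞ :=
  ⨆ x : X, ENNReal.ofReal |f x - g x|

/-- The sample `(x_j, y_j)`, `y_j = f(x_j) + ε_j`, as a function of the design points and noises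
`ω j = (x_j, ε_j)`. -/
def sample {X : Type*} {n : ℕ} (f : X → ℝ) (ω : Fin n → X × ℝ) : Fin n → X × ℝ :=
  fun j => ((ω j).1, f (ω j).1 + (ω j).2)

/-- The expected error `E ‖f̂ - f‖_∞` when `x_1, …, x_n ∼ μ` and `ε_1, …, ε_n ∼ N(0, σ²)` are
independent and `f̂` is computed from the sample `(x_j, f(x_j) + ε_j)`. -/
noncomputable def supRisk {X : Type*} [MeasurableSpace X] (μ : Measure X) (σ : ℝ) {n : ℕ}
    (fhat : (Fin n → X × ℝ) → X → ℝ) (f : X → ℝ) : ℝ≥0∞ :=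
  ∫⁻ ω, supDist (fhat (sample f ω)) f
    ∂(Measure.pi fun _ : Fin n => μ.prod (gaussianReal 0 (σ ^ 2).toNNReal))

/-- A learning method for samples of size `n`: a map from samples to functions on `X` whose value
at each point is a measurable function of the sample. -/
def IsEstimator {X : Type*} [MeasurableSpace X] {n : ℕ}
    (fhat : (Fin n → X × ℝ) → X → ℝ) : Prop :=
  ∀ x, Measurable fun D => fhat D x

/-- The minimax risk `inf_{f̂} sup_{f ∈ F} E ‖f̂ - f‖_∞` for samples of size `n`. -/
noncomputable def minimaxRisk {X : Type*} [MeasurableSpace X] (μ : Measure X) (σ : ℝ)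
    (F : Set (X → ℝ)) (n : ℕ) : ℝ≥0∞ :=
  ⨅ (fhat : (Fin n → X × ℝ) → X → ℝ) (_ : IsEstimator fhat), ⨆ f ∈ F, supRisk μ σ fhat f

end KernelRegression

/-!
The bound already follows from Le Cam's method with two hypotheses, one of which is the zero
function. If `f` has `L²(μ)` norm at most `σ / √n`, then `n` noisy observations of `f` cannot be
told from pure noise: the likelihood ratio of the two samples is a product of Gaussian density
ratios (`map_sample_eq_withDensity`), its square root has mean `(∫ exp (-f² / (8 σ²)) dμ) ^ n ≥ 7/8`
(`le_lintegral_sqrt_likelihoodRatio`), and so the two laws overlap in mass at least `1/2`. Hence the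
minimax risk in supremum norm is at least `|f x| / 4` at every point `x`
(`le_minimaxRisk_of_two_points`).

It remains to find a function in the interpolation ball with small `L²` norm and a high peak. The
sum of the first `m` squared eigenfunctions has mean `m`, so `N = ∑_{i ≤ m} e_i(x)² ≥ m` at some
point `x`. The function `f = τ ∑_{i ≤ m} e_i(x) e_i / √N` then has `L²` norm `τ` and value
`f x = τ √N ≥ τ √m`, and it lies in the ball of radius `R` as soon as `τ² ≤ R² λ_m^s`. Since
`λ_m ≥ c m^{-β}`, the two constraints `τ ≤ σ / √n` and `τ ≤ R λ_m^{s/2}` balance for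
`m ≈ n^{1/(sβ)}` and `τ ≈ n^{-1/2}`, which gives `f x ≈ n^{-1/2 + 1/(2sβ)}`
(`exists_amplitude_and_index`).
-/

namespace KernelRegression

/-! ### Change of measure for a Gaussian regression sample -/

/-- The density of `N(a, v)` with respect to `N(0, v)`. -/
noncomputable def gaussianRatio (v : ℝ≥0) (a y : ℝ) : ℝ :=
  Real.exp ((a * y - a ^ 2 / 2) / v)

lemma gaussianRatio_pos (v : ℝ≥0) (a y : ℝ) : 0 < gaussianRatio v a y := Real.exp_pos _

lemma measurable_uncurry_gaussianRatio (v : ℝ≥0) :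
    Measurable fun p : ℝ × ℝ => gaussianRatio v p.1 p.2 := by
  unfold gaussianRatio
  fun_prop

lemma gaussianPDF_eq_gaussianRatio_mul {v : ℝ≥0} (hv : v ≠ 0) (a y : ℝ) :
    gaussianPDF a v y = gaussianPDF 0 v y * ENNReal.ofReal (gaussianRatio v a y) := by
  have hv' : (v : ℝ) ≠ 0 := by exact_mod_cast hv
  rw [gaussianPDF, gaussianPDF, ← ENNReal.ofReal_mul (gaussianPDFReal_nonneg _ _ _)]
  congr 1
  simp only [gaussianPDFReal, gaussianRatio]
  rw [mul_assoc (Real.sqrt _)⁻¹, ← Real.exp_add]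
  congr 2
  field_simp
  ring

lemma lintegral_const_add_gaussianReal {v : ℝ≥0} (hv : v ≠ 0) (a : ℝ) {G : ℝ → ℝ≥0∞}
    (hG : Measurable G) :
    ∫⁻ y, G (a + y) ∂gaussianReal 0 v =
      ∫⁻ y, G y * ENNReal.ofReal (gaussianRatio v a y) ∂gaussianReal 0 v := by
  have hr : Measurable fun y => ENNReal.ofReal (gaussianRatio v a y) :=
    ((measurable_uncurry_gaussianRatio v).comp measurable_prodMk_left).ennreal_ofReal
  rw [← lintegral_map hG (by fun_prop), gaussianReal_map_const_add, zero_add,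
    gaussianReal_of_var_ne_zero _ hv, gaussianReal_of_var_ne_zero _ hv,
    lintegral_withDensity_eq_lintegral_mul _ (measurable_gaussianPDF _ _) hG]
  refine Eq.trans ?_ (lintegral_withDensity_eq_lintegral_mul _ (measurable_gaussianPDF _ _)
    (hG.mul hr)).symm
  refine lintegral_congr fun y => ?_
  simp only [Pi.mul_apply]
  rw [gaussianPDF_eq_gaussianRatio_mul hv]
  ring

lemma lintegral_gaussianRatio {v : ℝ≥0} (hv : v ≠ 0) (a : ℝ) :
    ∫⁻ y, ENNReal.ofReal (gaussianRatio v a y) ∂gaussianReal 0 v = 1 := by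
  simpa using (lintegral_const_add_gaussianReal hv a (G := fun _ => 1) measurable_const).symm

/-- The Hellinger affinity of `N(a, v)` and `N(0, v)`. It follows from the normalisation of
`N(a / 2, v)`, whose density is proportional to the square root of that of `N(a, v)`. -/
lemma lintegral_sqrt_gaussianRatio {v : ℝ≥0} (hv : v ≠ 0) (a : ℝ) :
    ∫⁻ y, ENNReal.ofReal (Real.sqrt (gaussianRatio v a y)) ∂gaussianReal 0 v =
      ENNReal.ofReal (Real.exp (-(a ^ 2 / (8 * v)))) := by
  have hv' : (v : ℝ) ≠ 0 := by exact_mod_cast hv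
  have key : ∀ y, Real.sqrt (gaussianRatio v a y) =
      Real.exp (-(a ^ 2 / (8 * v))) * gaussianRatio v (a / 2) y := by
    intro y
    rw [gaussianRatio, gaussianRatio, ← Real.exp_half, ← Real.exp_add]
    congr 1
    field_simp
    ring
  simp_rw [key, ENNReal.ofReal_mul (Real.exp_pos _).le]
  rw [lintegral_const_mul, lintegral_gaussianRatio hv, mul_one]
  exact ((measurable_uncurry_gaussianRatio v).comp measurable_prodMk_left).ennreal_ofReal

lemma lintegral_pi_prod {ι α : Type*} [Fintype ι] [MeasurableSpace α] (ν : Measure α)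
    [IsProbabilityMeasure ν] {g : ι → α → ℝ≥0∞} (hg : ∀ i, Measurable (g i)) :
    ∫⁻ ω, ∏ i, g i (ω i) ∂(Measure.pi fun _ : ι => ν) = ∏ i, ∫⁻ p, g i p ∂ν := by
  have h := lintegral_prod_eq_prod_lintegral_of_indepFun (μ := Measure.pi fun _ : ι => ν)
    Finset.univ (fun i ω => g i (ω i)) (iIndepFun_pi fun i => (hg i).aemeasurable)
    fun i => (hg i).comp (measurable_pi_apply i)
  rw [h]
  refine Finset.prod_congr rfl fun i _ => ?_
  exact (measurePreserving_eval (fun _ : ι => ν) i).lintegral_comp (hg i)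

/-- The likelihood ratio, at design points and observations `ω j = (x_j, y_j)`, of the regression
model with regression function `f` against the pure noise model. -/
noncomputable def likelihoodRatio (v : ℝ≥0) {X : Type*} {n : ℕ} (f : X → ℝ) (ω : Fin n → X × ℝ) : ℝ :=
  ∏ j, gaussianRatio v (f (ω j).1) (ω j).2

lemma likelihoodRatio_nonneg {X : Type*} (v : ℝ≥0) {n : ℕ} (f : X → ℝ) (ω : Fin n → X × ℝ) :
    0 ≤ likelihoodRatio v f ω :=
  Finset.prod_nonneg fun _ _ => (gaussianRatio_pos _ _ _).le

section Sample

variable {X : Type*} [MeasurableSpace X]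

lemma measurable_gaussianRatio_comp (v : ℝ≥0) {f : X → ℝ} (hf : Measurable f) :
    Measurable fun p : X × ℝ => gaussianRatio v (f p.1) p.2 :=
  (measurable_uncurry_gaussianRatio v).comp
    ((hf.comp measurable_fst).prodMk measurable_snd)

lemma measurable_likelihoodRatio (v : ℝ≥0) {n : ℕ} {f : X → ℝ} (hf : Measurable f) :
    Measurable (likelihoodRatio v (n := n) f) :=
  Finset.measurable_fun_prod _ fun j _ =>
    (measurable_gaussianRatio_comp v hf).comp (measurable_pi_apply j)

lemma measurable_sample {n : ℕ} {f : X → ℝ} (hf : Measurable f) :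
    Measurable (sample (n := n) f) := by
  unfold sample
  fun_prop

lemma map_shift_eq_withDensity (μ : Measure X) [IsProbabilityMeasure μ] {v : ℝ≥0} (hv : v ≠ 0)
    {f : X → ℝ} (hf : Measurable f) :
    (μ.prod (gaussianReal 0 v)).map (fun p => (p.1, f p.1 + p.2)) =
      (μ.prod (gaussianReal 0 v)).withDensity
        fun p => ENNReal.ofReal (gaussianRatio v (f p.1) p.2) := by
  have hm : Measurable fun p : X × ℝ => (p.1, f p.1 + p.2) := by fun_prop
  have hr := (measurable_gaussianRatio_comp v hf).ennreal_ofReal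
  ext s hs
  have hG : Measurable (s.indicator (1 : X × ℝ → ℝ≥0∞)) := measurable_one.indicator hs
  rw [← lintegral_indicator_one hs, ← lintegral_indicator_one hs, lintegral_map hG hm,
    lintegral_withDensity_eq_lintegral_mul _ hr hG,
    lintegral_prod _ (hr.mul hG).aemeasurable]
  refine (lintegral_prod _ (hG.comp hm).aemeasurable).trans ?_
  refine lintegral_congr fun x => ?_
  have := lintegral_const_add_gaussianReal hv (f x) (hG.comp (measurable_prodMk_left (x := x)))
  simpa [Function.comp_def, mul_comm] using this

/-- The sample with regression function `f` has density `likelihoodRatio v f` with respect to the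
sample of pure noise. -/
lemma map_sample_eq_withDensity (μ : Measure X) [IsProbabilityMeasure μ] {v : ℝ≥0} (hv : v ≠ 0)
    {n : ℕ} {f : X → ℝ} (hf : Measurable f) :
    (Measure.pi fun _ : Fin n => μ.prod (gaussianReal 0 v)).map (sample f) =
      (Measure.pi fun _ : Fin n => μ.prod (gaussianReal 0 v)).withDensity
        fun ω => ENNReal.ofReal (likelihoodRatio v f ω) := by
  have hm : Measurable fun p : X × ℝ => (p.1, f p.1 + p.2) := by fun_prop
  have hr := (measurable_gaussianRatio_comp v hf).ennreal_ofReal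
  have hprob : ∀ _ : Fin n, IsProbabilityMeasure
      ((μ.prod (gaussianReal 0 v)).map (fun p => (p.1, f p.1 + p.2))) :=
    fun _ => Measure.isProbabilityMeasure_map hm.aemeasurable
  have h := Measure.pi_map_pi (μ := fun _ : Fin n => μ.prod (gaussianReal 0 v))
    (f := fun _ p => (p.1, f p.1 + p.2)) fun _ => hm.aemeasurable
  refine h.trans ?_
  refine Measure.pi_eq fun s hs => ?_
  rw [withDensity_apply _ (MeasurableSet.univ_pi hs),
    ← lintegral_indicator (MeasurableSet.univ_pi hs)]
  have hind : ∀ ω : Fin n → X × ℝ, (Set.univ.pi s).indicator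
      (fun ω => ENNReal.ofReal (likelihoodRatio v f ω)) ω =
      ∏ j, (s j).indicator (fun p => ENNReal.ofReal (gaussianRatio v (f p.1) p.2)) (ω j) := by
    intro ω
    by_cases hω : ω ∈ Set.univ.pi s
    · rw [Set.indicator_of_mem hω, likelihoodRatio,
        ENNReal.ofReal_prod_of_nonneg fun _ _ => (gaussianRatio_pos _ _ _).le]
      exact Finset.prod_congr rfl fun j _ =>
        (Set.indicator_of_mem (hω j (Set.mem_univ j))
          (fun p : X × ℝ => ENNReal.ofReal (gaussianRatio v (f p.1) p.2))).symm
    · rw [Set.indicator_of_notMem hω]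
      obtain ⟨j, hj⟩ : ∃ j, ω j ∉ s j := by simpa [Set.mem_univ_pi] using hω
      exact (Finset.prod_eq_zero (Finset.mem_univ j) (Set.indicator_of_notMem hj _)).symm
  simp_rw [hind]
  rw [lintegral_pi_prod _ fun j => hr.indicator (hs j)]
  refine Finset.prod_congr rfl fun j _ => ?_
  rw [map_shift_eq_withDensity μ hv hf, withDensity_apply _ (hs j), lintegral_indicator (hs j)]

lemma lintegral_likelihoodRatio (μ : Measure X) [IsProbabilityMeasure μ] {v : ℝ≥0} (hv : v ≠ 0)
    {n : ℕ} {f : X → ℝ} (hf : Measurable f) :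
    ∫⁻ ω, ENNReal.ofReal (likelihoodRatio v f ω)
      ∂(Measure.pi fun _ : Fin n => μ.prod (gaussianReal 0 v)) = 1 := by
  have h := congrArg (fun m => m Set.univ) (map_sample_eq_withDensity μ hv (n := n) hf)
  simpa [Measure.map_apply (measurable_sample hf) MeasurableSet.univ] using h.symm

/-! ### Le Cam's two-point bound -/

/-- The Hellinger affinity of the regression model and the pure noise model is bounded below in
terms of the `L²` norm of the regression function alone. -/
lemma le_lintegral_sqrt_likelihoodRatio (μ : Measure X) [IsProbabilityMeasure μ] {v : ℝ≥0}
    (hv : v ≠ 0) {n : ℕ} {f : X → ℝ} (hf : Measurable f)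
    (hint : Integrable (fun x => f x ^ 2) μ) (hsmall : n * ∫ x, f x ^ 2 ∂μ ≤ v) :
    ENNReal.ofReal (7 / 8) ≤ ∫⁻ ω, ENNReal.ofReal (Real.sqrt (likelihoodRatio v f ω))
      ∂(Measure.pi fun _ : Fin n => μ.prod (gaussianReal 0 v)) := by
  have hv' : (0 : ℝ) < v := by
    exact_mod_cast pos_iff_ne_zero.mpr hv
  set I := ∫ x, f x ^ 2 ∂μ with hI
  have hI0 : 0 ≤ I := integral_nonneg fun x => sq_nonneg _
  have hmeas : Measurable fun p : X × ℝ =>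
      ENNReal.ofReal (Real.sqrt (gaussianRatio v (f p.1) p.2)) :=
    (measurable_gaussianRatio_comp v hf).sqrt.ennreal_ofReal
  have hprod : ∀ ω : Fin n → X × ℝ, ENNReal.ofReal (Real.sqrt (likelihoodRatio v f ω)) =
      ∏ j, ENNReal.ofReal (Real.sqrt (gaussianRatio v (f (ω j).1) (ω j).2)) := by
    intro ω
    rw [← ENNReal.ofReal_prod_of_nonneg fun _ _ => Real.sqrt_nonneg _, likelihoodRatio,
      Real.sqrt_prod _ fun _ _ => (gaussianRatio_pos _ _ _).le]
  simp_rw [hprod]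
  rw [lintegral_pi_prod _ fun _ => hmeas, Finset.prod_const, Finset.card_univ, Fintype.card_fin,
    lintegral_prod _ hmeas.aemeasurable]
  simp_rw [lintegral_sqrt_gaussianRatio hv]
  have hone : ENNReal.ofReal (1 - I / (8 * v)) ≤
      ∫⁻ x, ENNReal.ofReal (Real.exp (-(f x ^ 2 / (8 * v)))) ∂μ := by
    have hint' : Integrable (fun x => 1 - f x ^ 2 / (8 * v)) μ :=
      (integrable_const 1).sub (hint.div_const _)
    have : ∫ x, (1 - f x ^ 2 / (8 * v)) ∂μ = 1 - I / (8 * v) := by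
      rw [integral_sub (integrable_const 1) (hint.div_const _), integral_div]
      simp [hI]
    have hexp : Integrable (fun x => Real.exp (-(f x ^ 2 / (8 * v)))) μ := by
      refine Integrable.of_bound (C := 1) (by fun_prop) (Filter.Eventually.of_forall fun x => ?_)
      rw [Real.norm_eq_abs, abs_of_pos (Real.exp_pos _), Real.exp_le_one_iff, neg_nonpos]
      positivity
    rw [← this, ← ofReal_integral_eq_lintegral_ofReal hexp
      (Filter.Eventually.of_forall fun x => (Real.exp_pos _).le)]
    refine ENNReal.ofReal_le_ofReal (integral_mono hint' hexp fun x => ?_)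
    have := Real.add_one_le_exp (-(f x ^ 2 / (8 * v)))
    simp only
    linarith
  rcases Nat.eq_zero_or_pos n with rfl | hn
  · simp only [pow_zero]
    exact ENNReal.ofReal_le_one.mpr (by norm_num)
  have hn' : (1 : ℝ) ≤ n := by exact_mod_cast hn
  have hIv : n * (I / (8 * v)) ≤ 1 / 8 := by
    rw [← mul_div_assoc, div_le_div_iff₀ (by positivity) (by norm_num)]
    linarith
  have hIv0 : 0 ≤ I / (8 * v) := by positivity
  have hIv1 : I / (8 * v) ≤ 1 / 8 := by nlinarith
  refine le_trans ?_ (pow_le_pow_left' hone n)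
  rw [← ENNReal.ofReal_pow (by linarith)]
  refine ENNReal.ofReal_le_ofReal ?_
  have := one_add_mul_le_pow (a := -(I / (8 * v))) (by linarith) n
  calc (7 / 8 : ℝ) ≤ 1 + n * (-(I / (8 * v))) := by linarith
    _ ≤ (1 + -(I / (8 * v))) ^ n := this
    _ = (1 - I / (8 * v)) ^ n := by rw [← sub_eq_add_neg]

/-- A lower bound for the minimum of two densities with ratio `r` by their Hellinger density. -/
lemma four_mul_sqrt_le_min {r : ℝ} (hr : 0 ≤ r) :
    4 / 3 * Real.sqrt r ≤ min 1 r + (1 / 3 * r + 1 / 3) := by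
  have h := Real.sq_sqrt hr
  -- the two cases are the squares `(√r - 2)² ≥ 0` and `(2 √r - 1)² ≥ 0`
  rcases le_total 1 r with h1 | h1
  · rw [min_eq_left h1]
    nlinarith [sq_nonneg (Real.sqrt r - 2)]
  · rw [min_eq_right h1]
    nlinarith [sq_nonneg (2 * Real.sqrt r - 1)]

/-- The laws of the two samples overlap in mass at least `1 / 2`. -/
lemma half_le_lintegral_min_likelihoodRatio (μ : Measure X) [IsProbabilityMeasure μ] {v : ℝ≥0}
    (hv : v ≠ 0) {n : ℕ} {f : X → ℝ} (hf : Measurable f)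
    (hint : Integrable (fun x => f x ^ 2) μ) (hsmall : n * ∫ x, f x ^ 2 ∂μ ≤ v) :
    ENNReal.ofReal (1 / 2) ≤ ∫⁻ ω, ENNReal.ofReal (min 1 (likelihoodRatio v f ω))
      ∂(Measure.pi fun _ : Fin n => μ.prod (gaussianReal 0 v)) := by
  set P := Measure.pi fun _ : Fin n => μ.prod (gaussianReal 0 v)
  have hL : Measurable (likelihoodRatio v (n := n) f) := measurable_likelihoodRatio v hf
  have h1 : ENNReal.ofReal (4 / 3) * ENNReal.ofReal (7 / 8) ≤
      (∫⁻ ω, ENNReal.ofReal (min 1 (likelihoodRatio v f ω)) ∂P) +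
        (ENNReal.ofReal (1 / 3) * 1 + ENNReal.ofReal (1 / 3)) := by
    calc ENNReal.ofReal (4 / 3) * ENNReal.ofReal (7 / 8)
        ≤ ENNReal.ofReal (4 / 3) *
            ∫⁻ ω, ENNReal.ofReal (Real.sqrt (likelihoodRatio v f ω)) ∂P := by
          gcongr
          exact le_lintegral_sqrt_likelihoodRatio μ hv hf hint hsmall
      _ = ∫⁻ ω, ENNReal.ofReal (4 / 3 * Real.sqrt (likelihoodRatio v f ω)) ∂P := by
          simp_rw [ENNReal.ofReal_mul (show (0 : ℝ) ≤ 4 / 3 by norm_num)]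
          rw [lintegral_const_mul _ hL.sqrt.ennreal_ofReal]
      _ ≤ ∫⁻ ω, (ENNReal.ofReal (min 1 (likelihoodRatio v f ω)) +
            (ENNReal.ofReal (1 / 3) * ENNReal.ofReal (likelihoodRatio v f ω) +
              ENNReal.ofReal (1 / 3))) ∂P := by
          refine lintegral_mono fun ω => ?_
          have h0 := likelihoodRatio_nonneg v f ω
          rw [← ENNReal.ofReal_mul (by norm_num), ← ENNReal.ofReal_add (by positivity)
            (by norm_num), ← ENNReal.ofReal_add (by positivity) (by positivity)]
          exact ENNReal.ofReal_le_ofReal (four_mul_sqrt_le_min h0)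
      _ = _ := by
          rw [lintegral_add_left (measurable_const.min hL).ennreal_ofReal,
            lintegral_add_right _ measurable_const, lintegral_const_mul _ hL.ennreal_ofReal,
            lintegral_likelihoodRatio μ hv hf, lintegral_const, measure_univ, mul_one]
  rw [mul_one, ← ENNReal.ofReal_add (by norm_num) (by norm_num),
    ← ENNReal.ofReal_mul (by norm_num)] at h1
  have h2 := tsub_le_iff_right.mpr h1
  rw [← ENNReal.ofReal_sub _ (by norm_num)] at h2
  norm_num at h2 ⊢
  exact h2

/-- Le Cam's two-point bound: if the `L²` norm of `f` is at most the noise level `σ / √n`, then no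
estimator can tell `f` from `0`, and one of the two risks is at least `|f x| / 4` whatever `x`. -/
lemma le_supRisk_zero_add_supRisk (μ : Measure X) [IsProbabilityMeasure μ] {σ : ℝ} (hσ : 0 < σ)
    {n : ℕ} {f : X → ℝ} (hf : Measurable f)
    (hint : Integrable (fun x => f x ^ 2) μ) (hsmall : n * ∫ x, f x ^ 2 ∂μ ≤ σ ^ 2) (x : X)
    {fhat : (Fin n → X × ℝ) → X → ℝ} (hfhat : IsEstimator fhat) :
    ENNReal.ofReal (|f x| * (1 / 2)) ≤ supRisk μ σ fhat (fun _ => 0) + supRisk μ σ fhat f := by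
  set v := (σ ^ 2).toNNReal with hvdef
  have hvσ : (v : ℝ) = σ ^ 2 := Real.coe_toNNReal _ (sq_nonneg σ)
  have hv : v ≠ 0 := by
    rw [← NNReal.coe_ne_zero, hvσ]
    positivity
  have hG : ∀ a : ℝ, Measurable fun D => ENNReal.ofReal |fhat D x - a| := fun a =>
    ((hfhat x).sub_const a).abs.ennreal_ofReal
  have hL : Measurable (likelihoodRatio v (n := n) f) := measurable_likelihoodRatio v hf
  have h0 : ∫⁻ ω, ENNReal.ofReal |fhat ω x - 0|
      ∂(Measure.pi fun _ : Fin n => μ.prod (gaussianReal 0 v)) ≤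
        supRisk μ σ fhat (fun _ => 0) := by
    refine lintegral_mono fun ω => ?_
    have : sample (fun _ : X => (0 : ℝ)) ω = ω := by
      funext j
      simp [sample]
    rw [this]
    exact le_iSup (fun x => ENNReal.ofReal |fhat ω x - (0 : ℝ)|) x
  have h1 : ∫⁻ ω, ENNReal.ofReal (likelihoodRatio v f ω) * ENNReal.ofReal |fhat ω x - f x|
      ∂(Measure.pi fun _ : Fin n => μ.prod (gaussianReal 0 v)) ≤ supRisk μ σ fhat f := by
    have := lintegral_withDensity_eq_lintegral_mul
      (Measure.pi fun _ : Fin n => μ.prod (gaussianReal 0 v)) hL.ennreal_ofReal (hG (f x))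
    simp only [Pi.mul_apply] at this
    rw [← this, ← map_sample_eq_withDensity μ hv hf,
      lintegral_map (hG (f x)) (measurable_sample hf)]
    exact lintegral_mono fun ω =>
      le_iSup (fun x => ENNReal.ofReal |fhat (sample f ω) x - f x|) x
  refine le_trans ?_ (add_le_add h0 h1)
  rw [← lintegral_add_left (hG 0), ENNReal.ofReal_mul (abs_nonneg _)]
  refine (mul_le_mul_right (half_le_lintegral_min_likelihoodRatio μ hv hf hint
    (hvσ ▸ hsmall)) _).trans ?_
  rw [← lintegral_const_mul _ (measurable_const.min hL).ennreal_ofReal]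
  refine lintegral_mono fun ω => ?_
  have hL0 := likelihoodRatio_nonneg v f ω
  rw [← ENNReal.ofReal_mul (abs_nonneg _), ← ENNReal.ofReal_mul hL0,
    ← ENNReal.ofReal_add (abs_nonneg _) (by positivity)]
  refine ENNReal.ofReal_le_ofReal ?_
  calc |f x| * min 1 (likelihoodRatio v f ω)
      ≤ (|fhat ω x - 0| + |fhat ω x - f x|) * min 1 (likelihoodRatio v f ω) := by
        gcongr
        calc |f x| = |(fhat ω x - 0) - (fhat ω x - f x)| := by ring_nf
          _ ≤ _ := abs_sub _ _
    _ = |fhat ω x - 0| * min 1 (likelihoodRatio v f ω) +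
          min 1 (likelihoodRatio v f ω) * |fhat ω x - f x| := by ring
    _ ≤ _ := by
        gcongr
        · exact mul_le_of_le_one_right (abs_nonneg _) (min_le_left _ _)
        · exact min_le_right _ _

lemma le_minimaxRisk_of_two_points (μ : Measure X) [IsProbabilityMeasure μ] {σ : ℝ} (hσ : 0 < σ)
    {n : ℕ} {F : Set (X → ℝ)} (h0F : (fun _ => 0) ∈ F) {f : X → ℝ} (hfF : f ∈ F)
    (hf : Measurable f) (hint : Integrable (fun x => f x ^ 2) μ)
    (hsmall : n * ∫ x, f x ^ 2 ∂μ ≤ σ ^ 2) (x : X) :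
    ENNReal.ofReal (|f x| / 4) ≤ minimaxRisk μ σ F n := by
  refine le_iInf₂ fun fhat hfhat => ?_
  have h := le_supRisk_zero_add_supRisk μ hσ hf hint hsmall x hfhat
  have hle : ∀ g ∈ F, supRisk μ σ fhat g ≤ ⨆ f ∈ F, supRisk μ σ fhat f := fun g hg =>
    le_iSup₂ (f := fun f (_ : f ∈ F) => supRisk μ σ fhat f) g hg
  have h2 := h.trans (add_le_add (hle _ h0F) (hle _ hfF))
  rw [← two_mul, show |f x| * (1 / 2) = 2 * (|f x| / 4) by ring,
    ENNReal.ofReal_mul (by norm_num), ENNReal.ofReal_ofNat] at h2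
  exact (ENNReal.mul_le_mul_iff_right (by norm_num) (by norm_num)).mp h2

end Sample

/-! ### Eigenfunctions and the interpolation ball -/

lemma HolderKernel.continuous {X : Type*} [PseudoMetricSpace X] {k : X → X → ℝ} {h L : ℝ}
    (hk : HolderKernel k h L) (hh : 0 < h) : Continuous (Function.uncurry k) := by
  rw [continuous_iff_continuousAt]
  rintro ⟨x, y⟩
  refine tendsto_iff_dist_tendsto_zero.mpr ?_
  have hbound : Filter.Tendsto (fun p : X × X =>
      L * Real.sqrt (dist p.1 x ^ 2 + dist p.2 y ^ 2) ^ (2 * h)) (nhds (x, y)) (nhds 0) := by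
    have hc : Continuous fun p : X × X =>
        L * Real.sqrt (dist p.1 x ^ 2 + dist p.2 y ^ 2) ^ (2 * h) :=
      continuous_const.mul (Continuous.rpow_const (by fun_prop) fun _ => Or.inr (by positivity))
    have := hc.tendsto (x, y)
    simpa [Real.zero_rpow (by positivity : 2 * h ≠ 0), hh.ne'] using this
  exact squeeze_zero (fun _ => dist_nonneg) (fun p => hk p.1 p.2 x y) hbound

section

variable {X : Type*} [MeasurableSpace X] {μ : Measure X} {k : X → X → ℝ}
  {lam : ℕ → ℝ} {e : ℕ → X → ℝ}

/-- Eigenfunctions are measurable, and not only almost everywhere equal to measurable functions,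
because they are images under the integral operator. -/
lemma IsEigensystem.measurable_eigenfunction [SFinite μ] (hE : IsEigensystem μ k lam e)
    (hk : Measurable (Function.uncurry k)) (i : ℕ) : Measurable (e i) := by
  obtain ⟨g, hg, hge⟩ := (hE.memLp i).1
  have heq : e i = fun x => (lam i)⁻¹ * ∫ ξ, k x ξ * g ξ ∂μ := by
    funext x
    have hint : ∫ ξ, k x ξ * g ξ ∂μ = lam i * e i x := by
      rw [← hE.eigen i x, integralOp]
      refine integral_congr_ae ?_
      filter_upwards [hge] with ξ hξ
      rw [hξ]
    rw [hint, inv_mul_cancel_left₀ (hE.pos i).ne']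
  rw [heq]
  have hsm : StronglyMeasurable (Function.uncurry fun x ξ => k x ξ * g ξ) :=
    hk.stronglyMeasurable.mul (hg.comp_measurable measurable_snd)
  exact hsm.integral_prod_right.measurable.const_mul _

lemma IsEigensystem.integrable_mul (hE : IsEigensystem μ k lam e) (i j : ℕ) :
    Integrable (fun x => e i x * e j x) μ :=
  (hE.memLp i).integrable_mul (hE.memLp j)

/-- The mean of `∑_{i < m} e_i²` is `m`, so this sum is at least `m` at some point. -/
lemma IsEigensystem.exists_le_sum_sq [IsProbabilityMeasure μ] (hE : IsEigensystem μ k lam e)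
    (m : ℕ) : ∃ x, (m : ℝ) ≤ ∑ i ∈ Finset.range m, e i x ^ 2 := by
  have hint : ∀ i ∈ Finset.range m, Integrable (fun x => e i x ^ 2) μ := fun i _ => by
    simpa only [sq] using hE.integrable_mul i i
  obtain ⟨x, hx⟩ := exists_integral_le (integrable_finsetSum _ hint)
  refine ⟨x, le_trans (le_of_eq ?_) hx⟩
  rw [integral_finsetSum _ hint]
  simp [sq, hE.orthonormal]

lemma IsEigensystem.integrable_sq_sum (hE : IsEigensystem μ k lam e) (b : ℕ → ℝ) (m : ℕ) :
    Integrable (fun x => (∑ i ∈ Finset.range m, b i * e i x) ^ 2) μ :=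
  (memLp_finsetSum _ fun i _ => (hE.memLp i).const_mul (b i)).integrable_sq

lemma IsEigensystem.integral_sq_sum (hE : IsEigensystem μ k lam e) (b : ℕ → ℝ) (m : ℕ) :
    ∫ x, (∑ i ∈ Finset.range m, b i * e i x) ^ 2 ∂μ = ∑ i ∈ Finset.range m, b i ^ 2 := by
  have hint : ∀ i j, Integrable (fun x => b i * b j * (e i x * e j x)) μ := fun i j =>
    (hE.integrable_mul i j).const_mul _
  calc ∫ x, (∑ i ∈ Finset.range m, b i * e i x) ^ 2 ∂μ
      = ∫ x, ∑ i ∈ Finset.range m, ∑ j ∈ Finset.range m, b i * b j * (e i x * e j x) ∂μ := by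
        congr 1 with x
        rw [sq, Finset.sum_mul_sum]
        exact Finset.sum_congr rfl fun i _ => Finset.sum_congr rfl fun j _ => by ring
    _ = ∑ i ∈ Finset.range m, ∑ j ∈ Finset.range m, b i * b j * (if i = j then 1 else 0) := by
        rw [integral_finsetSum _ fun i _ => integrable_finsetSum _ fun j _ => hint i j]
        refine Finset.sum_congr rfl fun i _ => ?_
        rw [integral_finsetSum _ fun j _ => hint i j]
        refine Finset.sum_congr rfl fun j _ => ?_
        rw [integral_const_mul, hE.orthonormal]
    _ = ∑ i ∈ Finset.range m, b i ^ 2 := by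
        refine Finset.sum_congr rfl fun i hi => ?_
        simp only [mul_ite, mul_one, mul_zero, Finset.sum_ite_eq, if_pos hi, sq]

end

/-- A linear combination of the first eigenfunctions lies in the interpolation ball if its `L²`
norm is small enough compared with the last eigenvalue involved. -/
lemma sum_mem_interpolationBall {X : Type*} {lam : ℕ → ℝ} {e : ℕ → X → ℝ} {s R : ℝ} (hR : 0 ≤ R)
    (hs : 0 ≤ s) (hpos : ∀ i, 0 < lam i) (hanti : Antitone lam) (b : ℕ → ℝ) (m : ℕ)
    (hb : ∑ i ∈ Finset.range (m + 1), b i ^ 2 ≤ R ^ 2 * lam m ^ s) :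
    (fun x => ∑ i ∈ Finset.range (m + 1), b i * e i x) ∈ interpolationBall lam e s R := by
  set a : ℕ → ℝ := fun i => if i ∈ Finset.range (m + 1) then b i / lam i ^ (s / 2) else 0 with ha
  have ha0 : ∀ i ∉ Finset.range (m + 1), a i = 0 := fun i hi => if_neg hi
  have hzero : ∀ i ∉ Finset.range (m + 1), ‖a i‖ ^ (2 : ℝ≥0∞).toReal = 0 := fun i hi => by
    simp [ha0 i hi]
  have hmem : Memℓp a 2 := memℓp_gen (summable_of_ne_finset_zero hzero)
  refine ⟨⟨a, hmem⟩, ?_, fun x => ?_⟩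
  · refine lp.norm_le_of_tsum_le (by simp) hR ?_
    rw [tsum_eq_sum hzero]
    simp only [ENNReal.toReal_ofNat, Real.rpow_ofNat, Real.norm_eq_abs, sq_abs]
    have hm := Real.rpow_pos_of_pos (hpos m) s
    calc ∑ i ∈ Finset.range (m + 1), a i ^ 2
        ≤ ∑ i ∈ Finset.range (m + 1), b i ^ 2 / lam m ^ s := by
          refine Finset.sum_le_sum fun i hi => ?_
          have hsq : (lam i ^ (s / 2)) ^ 2 = lam i ^ s := by
            rw [← Real.rpow_natCast, ← Real.rpow_mul (hpos i).le]
            norm_num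
          rw [ha]
          simp only [if_pos hi, div_pow, hsq]
          gcongr
          · exact (hpos m).le
          · exact hanti (Nat.lt_succ_iff.mp (Finset.mem_range.mp hi))
      _ = (∑ i ∈ Finset.range (m + 1), b i ^ 2) / lam m ^ s := by rw [Finset.sum_div]
      _ ≤ R ^ 2 := (div_le_iff₀ hm).mpr hb
  · have hsum : ∑ i ∈ Finset.range (m + 1), b i * e i x =
        ∑ i ∈ Finset.range (m + 1), a i * lam i ^ (s / 2) * e i x := by
      refine Finset.sum_congr rfl fun i hi => ?_
      rw [ha]
      simp only [if_pos hi]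
      rw [div_mul_cancel₀ _ (Real.rpow_pos_of_pos (hpos i) _).ne']
    simp only
    rw [hsum]
    refine hasSum_sum_of_ne_finset_zero fun i hi => ?_
    simp [ha0 i hi]

lemma zero_mem_interpolationBall {X : Type*} (lam : ℕ → ℝ) (e : ℕ → X → ℝ) (s : ℝ) {R : ℝ}
    (hR : 0 ≤ R) : (fun _ => 0) ∈ interpolationBall lam e s R :=
  ⟨0, by simpa using hR, fun x => by simp⟩

/-! ### The lower bound -/

/-- The risk is bounded below by the height of a peak `τ ∑_{i ≤ m} e_i(x) e_i / √N`, where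
`N = ∑_{i ≤ m} e_i(x)²`, which has `L²` norm `τ` and height `τ √N` at `x`. -/
lemma IsEigensystem.le_minimaxRisk {X : Type*} [MeasurableSpace X] {μ : Measure X}
    [IsProbabilityMeasure μ] {k : X → X → ℝ} {lam : ℕ → ℝ} {e : ℕ → X → ℝ}
    (hE : IsEigensystem μ k lam e) (hk : Measurable (Function.uncurry k)) {s R σ τ : ℝ}
    (hR : 0 ≤ R) (hs : 0 ≤ s) (hσ : 0 < σ) (hτ : 0 ≤ τ) {n m : ℕ} (hτσ : n * τ ^ 2 ≤ σ ^ 2)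
    (hτR : τ ^ 2 ≤ R ^ 2 * lam m ^ s) :
    ENNReal.ofReal (τ * Real.sqrt (m + 1) / 4) ≤
      minimaxRisk μ σ (interpolationBall lam e s R) n := by
  obtain ⟨x, hx⟩ := hE.exists_le_sum_sq (m + 1)
  push_cast at hx
  set N := ∑ i ∈ Finset.range (m + 1), e i x ^ 2 with hN
  have hNpos : 0 < N := by
    have : (0 : ℝ) ≤ m := m.cast_nonneg
    linarith
  have hsqrt : 0 < Real.sqrt N := Real.sqrt_pos.mpr hNpos
  set b : ℕ → ℝ := fun i => τ / Real.sqrt N * e i x with hb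
  have hbsum : ∑ i ∈ Finset.range (m + 1), b i ^ 2 = τ ^ 2 := by
    simp only [hb, mul_pow, ← Finset.mul_sum, ← hN]
    rw [div_pow, Real.sq_sqrt hNpos.le, div_mul_cancel₀ _ hNpos.ne']
  have hval : ∑ i ∈ Finset.range (m + 1), b i * e i x = τ * Real.sqrt N := by
    have : ∀ i, b i * e i x = τ / Real.sqrt N * e i x ^ 2 := fun i => by
      simp only [hb]
      ring
    simp only [this, ← Finset.mul_sum, ← hN]
    rw [div_mul_eq_mul_div, div_eq_iff hsqrt.ne', mul_assoc, Real.mul_self_sqrt hNpos.le]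
  have hf : Measurable fun y => ∑ i ∈ Finset.range (m + 1), b i * e i y :=
    Finset.measurable_fun_sum _ fun i _ => (hE.measurable_eigenfunction hk i).const_mul _
  refine le_trans (ENNReal.ofReal_le_ofReal ?_) (le_minimaxRisk_of_two_points μ hσ
    (zero_mem_interpolationBall lam e s hR)
    (sum_mem_interpolationBall hR hs hE.pos hE.antitone b m (hbsum.trans_le hτR)) hf
    (hE.integrable_sq_sum b (m + 1)) (by rwa [hE.integral_sq_sum, hbsum]) x)
  rw [hval, abs_of_nonneg (by positivity)]
  gcongr

/-- Eigenvalue decay of order `β` allows the choice `m ≈ n^{1 / (s β)}`, `τ ≈ n^{-1/2}` in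
`IsEigensystem.le_minimaxRisk`, for which both constraints on `τ` are of the same order. -/
lemma exists_amplitude_and_index {β c s σ R : ℝ} (hβ : 0 < β) (hc : 0 < c) (hs : 0 < s)
    (hσ : 0 < σ) (hR : 0 < R) :
    ∃ τ₀ : ℝ, 0 < τ₀ ∧ ∀ n : ℕ, 1 ≤ n → ∃ (τ : ℝ) (m : ℕ), 0 ≤ τ ∧ n * τ ^ 2 ≤ σ ^ 2 ∧
      τ ^ 2 ≤ R ^ 2 * (c * ((m : ℝ) + 1) ^ (-β)) ^ s ∧
      τ₀ * (n : ℝ) ^ (-((s * β - 1) / (2 * s * β))) ≤ τ * Real.sqrt (m + 1) := by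
  set A := c ^ s / 2 ^ (s * β) with hA
  have hApos : 0 < A := by positivity
  set τ₀ := min σ (R * Real.sqrt A) with hτ₀
  have hτ₀pos : 0 < τ₀ := lt_min hσ (mul_pos hR (Real.sqrt_pos.mpr hApos))
  have hτ₀R : τ₀ ^ 2 ≤ R ^ 2 * A := by
    calc τ₀ ^ 2 ≤ (R * Real.sqrt A) ^ 2 := by
          gcongr
          exact min_le_right _ _
      _ = R ^ 2 * A := by rw [mul_pow, Real.sq_sqrt hApos.le]
  refine ⟨τ₀, hτ₀pos, fun n hn => ?_⟩
  have hn1 : (1 : ℝ) ≤ n := by exact_mod_cast hn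
  have hn0 : (0 : ℝ) < n := by linarith
  set p := (n : ℝ) ^ (1 / (s * β)) with hp
  have hp1 : 1 ≤ p := Real.one_le_rpow hn1 (by positivity)
  -- `m + 1 = ⌊p⌋ + 1` lies between `p` and `2 p`; the factor `2` accounts for `2 ^ (s β)` in `A`
  have hle : p ≤ (⌊p⌋₊ : ℝ) + 1 := (Nat.lt_floor_add_one p).le
  have hge : (⌊p⌋₊ : ℝ) + 1 ≤ 2 * p := by
    linarith [Nat.floor_le (zero_le_one.trans hp1)]
  have hsq : (τ₀ / Real.sqrt n) ^ 2 = τ₀ ^ 2 / n := by rw [div_pow, Real.sq_sqrt hn0.le]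
  refine ⟨τ₀ / Real.sqrt n, ⌊p⌋₊, by positivity, ?_, ?_, ?_⟩
  · rw [hsq, mul_div_cancel₀ _ hn0.ne']
    gcongr
    exact min_le_left _ _
  · rw [hsq, Real.mul_rpow hc.le (by positivity), ← Real.rpow_mul (by positivity)]
    have h1 : A / n ≤ c ^ s * ((⌊p⌋₊ : ℝ) + 1) ^ (-β * s) := by
      calc A / n = c ^ s * (2 * p) ^ (-β * s) := by
            rw [Real.mul_rpow (by norm_num) (by positivity), hp, ← Real.rpow_mul hn0.le,
              show 1 / (s * β) * (-β * s) = -1 by field_simp, Real.rpow_neg_one,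
              show -β * s = -(s * β) by ring, Real.rpow_neg (by norm_num), hA]
            ring
        _ ≤ _ := mul_le_mul_of_nonneg_left
            (Real.rpow_le_rpow_of_nonpos (by positivity) hge
              (by nlinarith [mul_pos hβ hs])) (by positivity)
    calc τ₀ ^ 2 / n ≤ R ^ 2 * A / n := by gcongr
      _ = R ^ 2 * (A / n) := by ring
      _ ≤ _ := by gcongr
  · have hexp : (n : ℝ) ^ (-((s * β - 1) / (2 * s * β))) = Real.sqrt p / Real.sqrt n := by
      rw [Real.sqrt_eq_rpow, Real.sqrt_eq_rpow, hp, ← Real.rpow_mul hn0.le,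
        ← Real.rpow_sub hn0]
      congr 1
      field_simp
      ring
    rw [hexp]
    calc τ₀ * (Real.sqrt p / Real.sqrt n) = τ₀ / Real.sqrt n * Real.sqrt p := by ring
      _ ≤ _ := by gcongr

end KernelRegression

theorem mainTheorem3 (d : ℕ) (β c L h s σ R : ℝ) (hβ : 0 < β) (hc : 0 < c) (hL : 0 < L)
    (hh : 0 < h) (hh' : h ≤ 1 / 2) (hs : 1 / β < s) (hσ : 0 < σ) (hR : 0 < R) :
    ∃ C : ℝ, 0 < C ∧
      ∀ (X : Set (EuclideanSpace ℝ (Fin d))) (_ : IsCompact X)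
        (μ : MeasureTheory.Measure X) (_ : MeasureTheory.IsProbabilityMeasure μ)
        (k : X → X → ℝ) (lam : ℕ → ℝ) (e : ℕ → X → ℝ) (c' : ℝ),
        (Matrix.of k).PosSemidef →
        KernelRegression.IsEigensystem μ k lam e →
        KernelRegression.EigenvalueDecay lam β c c' →
        KernelRegression.HolderKernel k h L →
        KernelRegression.IsEmbeddingIndex lam e β (1 / β) →
        ∀ n : ℕ, 1 ≤ n →
          ENNReal.ofReal (C * (n : ℝ) ^ (-((s * β - 1) / (2 * s * β)))) ≤
              KernelRegression.minimaxRisk μ σ (KernelRegression.interpolationBall lam e s R) n ∧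
          ∀ K ε : ℝ, 0 < K → 0 < ε →
            ENNReal.ofReal (K * (n : ℝ) ^ (-((s * β - 1) / (2 * s * β)) + ε)) ≤
              ENNReal.ofReal (K / C * (n : ℝ) ^ ε) *
                KernelRegression.minimaxRisk μ σ (KernelRegression.interpolationBall lam e s R) n
          := by
  have hs0 : 0 < s := (one_div_pos.mpr hβ).trans hs
  obtain ⟨τ₀, hτ₀, hchoice⟩ := KernelRegression.exists_amplitude_and_index hβ hc hs0 hσ hR
  refine ⟨τ₀ / 4, by positivity, ?_⟩
  intro X _ μ _ k lam e c' _ hE hdecay hholder _ n hn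
  have hn0 : (0 : ℝ) < n := by exact_mod_cast hn
  have hlower : ENNReal.ofReal (τ₀ / 4 * (n : ℝ) ^ (-((s * β - 1) / (2 * s * β)))) ≤
      KernelRegression.minimaxRisk μ σ (KernelRegression.interpolationBall lam e s R) n := by
    obtain ⟨τ, m, hτ, hτσ, hτR, hrate⟩ := hchoice n hn
    refine le_trans (ENNReal.ofReal_le_ofReal ?_) (hE.le_minimaxRisk
      (hholder.continuous hh).measurable hR.le hs0.le hσ hτ (m := m) hτσ (hτR.trans ?_))
    · linarith
    · gcongr
      exact (hdecay m).1
  refine ⟨hlower, fun K ε hK _ => ?_⟩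
  calc ENNReal.ofReal (K * (n : ℝ) ^ (-((s * β - 1) / (2 * s * β)) + ε))
      = ENNReal.ofReal (K / (τ₀ / 4) * (n : ℝ) ^ ε) *
          ENNReal.ofReal (τ₀ / 4 * (n : ℝ) ^ (-((s * β - 1) / (2 * s * β)))) := by
        rw [← ENNReal.ofReal_mul (by positivity), Real.rpow_add hn0]
        congr 1
        field_simp
    _ ≤ _ := by gcongr
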